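/- Let $n\ge 1$ and let $K\subset\mathbb{R}^n$ be a compact convex set of dimension $n$ (that is, its affine hull is all of $\mathbb{R}^n$). For a unit vector $u$ and a set $S\subseteq\mathbb{R}^n$, let $S_u$ denote the orthogonal projection of $S$ onto the hyperplane $u^\perp$. Then there exists a nonempty compact convex set $L\subset\mathbb{R}^n$ such that, for every unit vector $u\in\mathbb{R}^n$, there is a vector $v\in u^\perp$ with $K_u+v\subseteq L_u$, while there is no vector $w\in\mathbb{R}^n$ with $K+w\subseteq L$. -/

import Mathlib

/-- The shadow `K_u`: the orthogonal projection of `K` onto the hyperplane `u^⊥` through the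
origin, regarded as a subset of the ambient space. -/
noncomputable def shadow {n : ℕ} (u : EuclideanSpace ℝ (Fin n))
    (K : Set (EuclideanSpace ℝ (Fin n))) : Set (EuclideanSpace ℝ (Fin n)) :=
  (Submodule.span ℝ {u})ᗮ.starProjection '' K

/-- The translate `K + v` of a set by a vector. -/
def setTranslate {n : ℕ} (K : Set (EuclideanSpace ℝ (Fin n))) (v : EuclideanSpace ℝ (Fin n)) :
    Set (EuclideanSpace ℝ (Fin n)) :=
  (fun x => x + v) '' K

/-- The dimension of a (nonempty) convex set: the dimension of its affine hull. -/
noncomputable def affineDim {n : ℕ} (K : Set (EuclideanSpace ℝ (Fin n))) : ℕ :=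
  Module.finrank ℝ (affineSpan ℝ K).direction

/-! Among (n+1)-tuples in `K`, let `x` maximize the homogeneous determinant plus a small multiple of
the spread. The partial differentials `g i` of this objective sum to zero, and its quadratic term
makes `x i` the unique maximizer of `g i` on `K` (`exists_exposing_functionals`). Let `L` be the
simplex `g i ≤ g i (x i) - δ`. If `K + w ⊆ L`, testing at `x i` gives `g i w ≤ -δ` for every `i`,
against the zero sum. For shadows, motion along `u` is free. Translate so that every constraint
except one, `k`, is relaxed by `δ`; points near `x k` have room in the other constraints, so sliding
along `u` repairs the `k`-th (`exists_uniform_sliding`). -/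

/-- The square matrix whose rows are the points `x i` in homogeneous coordinates. -/
def homogeneousMatrix {n : ℕ} (x : Fin (n + 1) → EuclideanSpace ℝ (Fin n)) :
    Matrix (Fin (n + 1)) (Fin (n + 1)) ℝ :=
  Matrix.of fun i => Fin.cons 1 (x i)

theorem exists_homogeneousMatrix_det_pos {n : ℕ} (hn : 1 ≤ n)
    {K : Set (EuclideanSpace ℝ (Fin n))} (hK : affineSpan ℝ K = ⊤) :
    ∃ p : Fin (n + 1) → EuclideanSpace ℝ (Fin n),
      (∀ i, p i ∈ K) ∧ 0 < (homogeneousMatrix p).det := by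
  obtain ⟨s, hs, b, hb⟩ := AffineBasis.exists_affine_subbasis hK
  have hfin : Finite s := b.finite
  have := Fintype.ofFinite s
  have hcard : Fintype.card s = n + 1 := by
    rw [b.card_eq_finrank_add_one]; simp
  let e : Fin (n + 1) ≃ s := (Fintype.equivFinOfCardEq hcard).symm
  let q : Fin (n + 1) → EuclideanSpace ℝ (Fin n) := fun i => b (e i)
  have hq : AffineIndependent ℝ q := b.ind.comp_embedding e.toEmbedding
  have hqK : ∀ i, q i ∈ K := fun i => by
    simp only [q, hb]; exact hs (e i).2
  have hdet : (homogeneousMatrix q).det ≠ 0 := by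
    intro h0
    obtain ⟨c, hc, h⟩ := Matrix.exists_vecMul_eq_zero_iff.2 h0
    apply hc
    rw [affineIndependent_iff] at hq
    have h1 : ∑ i, c i = 0 := by
      have := congrFun h 0
      simpa [Matrix.vecMul, dotProduct, homogeneousMatrix] using this
    have h2 : ∑ i, c i • q i = 0 := by
      ext k
      have := congrFun h k.succ
      simpa [Matrix.vecMul, dotProduct, homogeneousMatrix] using this
    funext i
    exact hq Finset.univ c h1 h2 i (Finset.mem_univ i)
  rcases lt_or_gt_of_ne hdet with h | h
  · obtain ⟨m, rfl⟩ : ∃ m, n = m + 1 := ⟨n - 1, by omega⟩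
    refine ⟨fun i => q (Equiv.swap 0 1 i), fun i => hqK _, ?_⟩
    have : homogeneousMatrix (fun i => q (Equiv.swap 0 1 i)) =
        (homogeneousMatrix q).submatrix (Equiv.swap 0 1) id := rfl
    rw [this, Matrix.det_permute, Equiv.Perm.sign_swap (by simp)]
    simpa using h
  · exact ⟨q, hqK, h⟩

/-- The differential of the homogeneous determinant with respect to the `i`-th point. -/
noncomputable def detDifferential {n : ℕ} (x : Fin (n + 1) → EuclideanSpace ℝ (Fin n))
    (i : Fin (n + 1)) : EuclideanSpace ℝ (Fin n) →ₗ[ℝ] ℝ where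
  toFun z := Matrix.cramer (homogeneousMatrix x).transpose (Fin.cons 0 z) i
  map_add' y z := by
    have : (Fin.cons 0 (y + z).ofLp : Fin (n + 1) → ℝ) =
        (Fin.cons 0 y : Fin (n + 1) → ℝ) + (Fin.cons 0 z : Fin (n + 1) → ℝ) := by
      ext j; refine Fin.cases ?_ (fun k => ?_) j <;> simp
    rw [this, map_add]; rfl
  map_smul' c z := by
    have : (Fin.cons 0 (c • z).ofLp : Fin (n + 1) → ℝ) = c • (Fin.cons 0 z : Fin (n + 1) → ℝ) := by
      ext j; refine Fin.cases ?_ (fun k => ?_) j <;> simp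
    rw [this, map_smul]; rfl

theorem sum_detDifferential {n : ℕ} (x : Fin (n + 1) → EuclideanSpace ℝ (Fin n))
    (z : EuclideanSpace ℝ (Fin n)) : ∑ i, detDifferential x i z = 0 := by
  have := congrFun (Matrix.mulVec_cramer (homogeneousMatrix x).transpose (Fin.cons 0 z)) 0
  simpa [Matrix.mulVec, dotProduct, homogeneousMatrix, detDifferential] using this

theorem sum_detDifferential_smul {n : ℕ} (x : Fin (n + 1) → EuclideanSpace ℝ (Fin n))
    (z : EuclideanSpace ℝ (Fin n)) :
    ∑ i, detDifferential x i z • x i = (homogeneousMatrix x).det • z := by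
  ext k
  have := congrFun (Matrix.mulVec_cramer (homogeneousMatrix x).transpose (Fin.cons 0 z)) k.succ
  simpa [Matrix.mulVec, dotProduct, homogeneousMatrix, detDifferential, mul_comm] using this

theorem homogeneousMatrix_det_update {n : ℕ} (x : Fin (n + 1) → EuclideanSpace ℝ (Fin n))
    (i : Fin (n + 1)) (y : EuclideanSpace ℝ (Fin n)) :
    (homogeneousMatrix (Function.update x i y)).det =
      (homogeneousMatrix x).det + detDifferential x i (y - x i) := by
  have h1 : homogeneousMatrix (Function.update x i y) =
      (homogeneousMatrix x).updateRow i
        ((homogeneousMatrix x) i + (Fin.cons 0 (y - x i).ofLp : Fin (n + 1) → ℝ)) := by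
    ext j k
    by_cases hj : j = i
    · subst hj
      refine Fin.cases ?_ (fun k => ?_) k <;> simp [homogeneousMatrix]
    · simp [homogeneousMatrix, hj]
  rw [h1, Matrix.det_updateRow_add, Matrix.updateRow_eq_self]
  congr 1
  change _ = Matrix.cramer _ _ _
  rw [Matrix.cramer_transpose_apply]

/-- The sum of the squared mutual distances of the points `x i`. -/
noncomputable def spread {n : ℕ} (x : Fin (n + 1) → EuclideanSpace ℝ (Fin n)) : ℝ :=
  (n + 1) * ∑ i, ‖x i‖ ^ 2 - ‖∑ i, x i‖ ^ 2

theorem spread_update {n : ℕ} (x : Fin (n + 1) → EuclideanSpace ℝ (Fin n))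
    (i : Fin (n + 1)) (y : EuclideanSpace ℝ (Fin n)) :
    spread (Function.update x i y) = spread x +
      2 * inner ℝ ((n + 1 : ℝ) • x i - ∑ j, x j) (y - x i) + n * ‖y - x i‖ ^ 2 := by
  have h1 : ∑ j, Function.update x i y j = ∑ j, x j + (y - x i) := by
    rw [Finset.sum_update_of_mem (Finset.mem_univ i),
      ← Finset.add_sum_erase _ _ (Finset.mem_univ i), Finset.sdiff_singleton_eq_erase]
    abel
  have h2 : ∑ j, ‖Function.update x i y j‖ ^ 2 = ∑ j, ‖x j‖ ^ 2 + (‖y‖ ^ 2 - ‖x i‖ ^ 2) := by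
    rw [← Finset.add_sum_erase _ _ (Finset.mem_univ i),
      ← Finset.add_sum_erase _ (fun j => ‖x j‖ ^ 2) (Finset.mem_univ i),
      Finset.sum_congr rfl fun j hj => by
        rw [Function.update_of_ne (Finset.ne_of_mem_erase hj)]]
    simp
    ring
  have h3 : ‖y‖ ^ 2 = ‖x i‖ ^ 2 + 2 * inner ℝ (x i) (y - x i) + ‖y - x i‖ ^ 2 := by
    rw [← norm_add_sq_real]; congr 2; abel
  rw [spread, spread, h1, h2, norm_add_sq_real, h3, inner_sub_left, real_inner_smul_left]
  ring

theorem exists_exposing_functionals {n : ℕ} (hn : 1 ≤ n)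
    {K : Set (EuclideanSpace ℝ (Fin n))} (hKc : IsCompact K) (hK : affineSpan ℝ K = ⊤) :
    ∃ (x : Fin (n + 1) → EuclideanSpace ℝ (Fin n))
      (g : Fin (n + 1) → EuclideanSpace ℝ (Fin n) →ₗ[ℝ] ℝ),
      (∀ i, x i ∈ K) ∧ Function.Injective x ∧ (∀ z, ∑ i, g i z = 0) ∧
      (∀ u, (∀ i, g i u = 0) → u = 0) ∧
      ∀ i, ∀ y ∈ K, y ≠ x i → g i y < g i (x i) := by
  obtain ⟨p, hpK, hp⟩ := exists_homogeneousMatrix_det_pos hn hK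
  have hcV : Continuous fun x : Fin (n + 1) → EuclideanSpace ℝ (Fin n) =>
      (homogeneousMatrix x).det := by
    refine Continuous.matrix_det (continuous_matrix fun i j => ?_)
    refine Fin.cases ?_ (fun k => ?_) j
    · simpa [homogeneousMatrix] using continuous_const
    · simp only [homogeneousMatrix, Matrix.of_apply, Fin.cons_succ]
      fun_prop
  have hcQ : Continuous fun x : Fin (n + 1) → EuclideanSpace ℝ (Fin n) => spread x := by
    unfold spread; fun_prop
  have hcomp : IsCompact (Set.univ.pi fun _ : Fin (n + 1) => K) :=
    isCompact_univ_pi fun _ => hKc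
  have hpmem : p ∈ Set.univ.pi fun _ : Fin (n + 1) => K := fun i _ => hpK i
  obtain ⟨C, hC⟩ := hcomp.exists_bound_of_continuousOn hcQ.continuousOn
  have hC0 : 0 ≤ C := (norm_nonneg _).trans (hC p hpmem)
  set V := (homogeneousMatrix p).det with hV
  -- So small that the spread term cannot cost the maximizer its positive determinant.
  obtain ⟨ε, hε, hεC⟩ : ∃ ε > 0, 2 * ε * C < V := by
    refine ⟨V / (2 * (C + 1)), by positivity, ?_⟩
    rw [show 2 * (V / (2 * (C + 1))) * C = V * (C / (C + 1)) by field_simp]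
    have : C / (C + 1) < 1 := by rw [div_lt_one (by positivity)]; linarith
    nlinarith
  obtain ⟨x, hxmem, hmax⟩ := hcomp.exists_isMaxOn ⟨p, hpmem⟩
    (f := fun x => (homogeneousMatrix x).det + ε * spread x) (by fun_prop)
  have hxV : 0 < (homogeneousMatrix x).det := by
    have h1 : V + ε * spread p ≤ (homogeneousMatrix x).det + ε * spread x := hmax hpmem
    have h2 := abs_le.1 (hC p hpmem)
    have h3 := abs_le.1 (hC x hxmem)
    nlinarith
  refine ⟨x, fun i => detDifferential x i +
    (2 * ε) • (innerSL ℝ ((n + 1 : ℝ) • x i - ∑ j, x j)).toLinearMap,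
    fun i => hxmem i (Set.mem_univ i), ?_, ?_, ?_, ?_⟩
  · intro i j hij
    by_contra hne
    refine hxV.ne' (Matrix.det_zero_of_row_eq hne ?_)
    change (Fin.cons 1 (x i).ofLp : Fin (n + 1) → ℝ) = Fin.cons 1 (x j).ofLp
    rw [hij]
  · intro z
    simp only [LinearMap.add_apply, LinearMap.smul_apply, Finset.sum_add_distrib,
      sum_detDifferential, zero_add, ← Finset.smul_sum, ContinuousLinearMap.coe_coe,
      innerSL_apply_apply, ← sum_inner]
    have : ∑ i, ((n + 1 : ℝ) • x i - ∑ j, x j) = 0 := by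
      rw [Finset.sum_sub_distrib, ← Finset.smul_sum, Finset.sum_const, Finset.card_univ,
        Fintype.card_fin, ← Nat.cast_smul_eq_nsmul ℝ]
      push_cast
      exact sub_self _
    rw [this]; simp
  · intro u hu
    -- Pairing with `inner ℝ (x i) u` turns the determinant part into `det * ‖u‖ ^ 2` and the spread
    -- part into a variance, nonnegative by Cauchy–Schwarz.
    have h1 : ∑ i, (detDifferential x i u +
        2 * ε * inner ℝ ((n + 1 : ℝ) • x i - ∑ j, x j) u) * inner ℝ (x i) u = 0 :=
      Finset.sum_eq_zero fun i _ => by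
        have := hu i
        simp only [LinearMap.add_apply, LinearMap.smul_apply, ContinuousLinearMap.coe_coe,
          innerSL_apply_apply, smul_eq_mul] at this
        rw [this, zero_mul]
    have h2 : ∑ i, detDifferential x i u * inner ℝ (x i) u =
        (homogeneousMatrix x).det * ‖u‖ ^ 2 := by
      rw [← real_inner_self_eq_norm_sq, ← real_inner_smul_left, ← sum_detDifferential_smul,
        sum_inner]
      simp [real_inner_smul_left]
    have h3 : ∑ i, inner ℝ ((n + 1 : ℝ) • x i - ∑ j, x j) u * inner ℝ (x i) u =
        (n + 1) * ∑ i, inner ℝ (x i) u ^ 2 - (∑ i, inner ℝ (x i) u) ^ 2 := by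
      simp only [inner_sub_left, real_inner_smul_left, sub_mul, Finset.sum_sub_distrib, sum_inner,
        ← Finset.mul_sum, mul_assoc, sq]
    have h4 : (∑ i, inner ℝ (x i) u) ^ 2 ≤ ((n : ℝ) + 1) * ∑ i, inner ℝ (x i) u ^ 2 := by
      simpa using sq_sum_le_card_mul_sum_sq (s := Finset.univ) (f := fun i => inner ℝ (x i) u)
    simp only [add_mul, Finset.sum_add_distrib, mul_assoc] at h1
    simp only [← Finset.mul_sum] at h1
    rw [h2, h3] at h1
    have h5 : 0 ≤ ε * ((n + 1) * ∑ i, inner ℝ (x i) u ^ 2 - (∑ i, inner ℝ (x i) u) ^ 2) :=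
      mul_nonneg hε.le (sub_nonneg.2 h4)
    have h6 : ‖u‖ ^ 2 ≤ 0 := by
      by_contra! h
      have := mul_pos hxV h
      linarith
    exact norm_eq_zero.1 (pow_eq_zero_iff two_ne_zero |>.1 (le_antisymm h6 (sq_nonneg _)))
  · intro i y hy hne
    have hmem : Function.update x i y ∈ Set.univ.pi fun _ : Fin (n + 1) => K := by
      intro j _
      by_cases hj : j = i
      · subst hj; simpa using hy
      · simpa [hj] using hxmem j (Set.mem_univ j)
    have h1 : (homogeneousMatrix (Function.update x i y)).det +
        ε * spread (Function.update x i y) ≤ (homogeneousMatrix x).det + ε * spread x := hmax hmem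
    rw [homogeneousMatrix_det_update, spread_update] at h1
    rw [← sub_neg, ← map_sub]
    simp only [LinearMap.add_apply, LinearMap.smul_apply, ContinuousLinearMap.coe_coe,
      innerSL_apply_apply, smul_eq_mul]
    -- The exact second-order term of `spread` makes the inequality strict; the determinant is
    -- affine in each point.
    have h2 : 0 < ε * (n * ‖y - x i‖ ^ 2) := by
      have := norm_pos_iff.2 (sub_ne_zero.2 hne)
      have : (0 : ℝ) < n := by exact_mod_cast hn
      positivity
    linarith

/-! ### Uniform slack and sliding -/

theorem exists_pos_forall_le_of_finite {ι : Type*} [Finite ι] {f : ι → ℝ} (hf : ∀ i, 0 < f i) :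
    ∃ η > 0, ∀ i, η ≤ f i := by
  rcases isEmpty_or_nonempty ι with h | h
  · exact ⟨1, one_pos, fun i => isEmptyElim i⟩
  · obtain ⟨i, hi⟩ := Finite.exists_min f
    exact ⟨f i, hf i, hi⟩

/-- No point is both `x i` and `x j`, so the larger of the two slacks is positive on `K`, and
compactness bounds it below. -/
theorem exists_uniform_slack {n : ℕ} {K : Set (EuclideanSpace ℝ (Fin n))} (hKc : IsCompact K)
    {ι : Type*} [Finite ι] {x : ι → EuclideanSpace ℝ (Fin n)}
    {g : ι → EuclideanSpace ℝ (Fin n) →ₗ[ℝ] ℝ} (hx : Function.Injective x)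
    (hg : ∀ i, ∀ y ∈ K, y ≠ x i → g i y < g i (x i)) :
    ∃ η > 0, ∀ y ∈ K, ∀ i j, i ≠ j → g i (x i) - g i y < η → η ≤ g j (x j) - g j y := by
  have key : ∀ p : {p : ι × ι // p.1 ≠ p.2}, ∃ η > 0, ∀ y ∈ K,
      η ≤ max (g p.1.1 (x p.1.1) - g p.1.1 y) (g p.1.2 (x p.1.2) - g p.1.2 y) := by
    rintro ⟨⟨i, j⟩, hij⟩
    rcases K.eq_empty_or_nonempty with rfl | hne
    · exact ⟨1, one_pos, by simp⟩
    have hci : Continuous (g i) := (g i).continuous_of_finiteDimensional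
    have hcj : Continuous (g j) := (g j).continuous_of_finiteDimensional
    obtain ⟨z, hz, hmin⟩ := hKc.exists_isMinOn hne
      (f := fun y => max (g i (x i) - g i y) (g j (x j) - g j y)) (by fun_prop)
    refine ⟨_, ?_, fun y hy => hmin hy⟩
    by_cases h : z = x i
    · refine lt_max_of_lt_right (sub_pos.2 (hg j z hz fun h' => hij (hx (h.symm.trans h'))))
    · exact lt_max_of_lt_left (sub_pos.2 (hg i z hz h))
  choose f hf hle using key
  obtain ⟨η, hη, hηf⟩ := exists_pos_forall_le_of_finite hf
  refine ⟨η, hη, fun y hy i j hij hlt => ?_⟩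
  have h := (hηf ⟨(i, j), hij⟩).trans (hle ⟨(i, j), hij⟩ y hy)
  exact (le_max_iff.1 h).resolve_left (not_le.2 hlt)

/-- The joint image of the `g i` has dimension `n` and lies in the zero-sum hyperplane, hence fills
it. -/
theorem exists_forall_apply_eq_of_sum_eq_zero {n : ℕ}
    {g : Fin (n + 1) → EuclideanSpace ℝ (Fin n) →ₗ[ℝ] ℝ} (hsum : ∀ z, ∑ i, g i z = 0)
    (hinj : ∀ u, (∀ i, g i u = 0) → u = 0) {b : Fin (n + 1) → ℝ} (hb : ∑ i, b i = 0) :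
    ∃ v, ∀ i, g i v = b i := by
  let s : (Fin (n + 1) → ℝ) →ₗ[ℝ] ℝ := ∑ i, LinearMap.proj i
  have hs : ∀ c, s c = ∑ i, c i := fun c => by simp [s]
  have hle : LinearMap.range (LinearMap.pi g) ≤ LinearMap.ker s := by
    rintro _ ⟨z, rfl⟩
    simp [hs, hsum]
  have hker : LinearMap.ker (LinearMap.pi g) = ⊥ :=
    LinearMap.ker_eq_bot'.2 fun u hu => hinj u fun i => congrFun hu i
  have hrange : LinearMap.range s = ⊤ := by
    refine LinearMap.range_eq_top.2 fun r => ⟨Pi.single 0 r, ?_⟩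
    simp [hs]
  have h1 := LinearMap.finrank_range_add_finrank_ker s
  have h2 := LinearMap.finrank_range_of_inj (LinearMap.ker_eq_bot.1 hker)
  rw [hrange] at h1
  simp only [finrank_top, Module.finrank_self, Module.finrank_fin_fun,
    finrank_euclideanSpace_fin] at h1 h2
  have heq := Submodule.eq_of_le_of_finrank_eq hle (by omega)
  have hbm : b ∈ LinearMap.range (LinearMap.pi g) := by
    rw [heq, LinearMap.mem_ker, hs, hb]
  obtain ⟨v, hv⟩ := hbm
  exact ⟨v, fun i => congrFun hv i⟩

theorem exists_pos_le_abs_apply {n : ℕ}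
    {g : Fin (n + 1) → EuclideanSpace ℝ (Fin n) →ₗ[ℝ] ℝ}
    (hinj : ∀ u, (∀ i, g i u = 0) → u = 0) :
    ∃ c > 0, ∀ u, ∃ i, c * ‖u‖ ≤ |g i u| := by
  have hker : LinearMap.ker (LinearMap.pi g) = ⊥ :=
    LinearMap.ker_eq_bot'.2 fun u hu => hinj u fun i => congrFun hu i
  obtain ⟨C, hC, hanti⟩ := LinearMap.exists_antilipschitzWith _ hker
  have hC' : (0 : ℝ) < C := hC
  refine ⟨(C : ℝ)⁻¹, by positivity, fun u => ?_⟩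
  obtain ⟨i, hi⟩ := Finite.exists_max fun i => |g i u|
  refine ⟨i, ?_⟩
  rw [inv_mul_le_iff₀ hC']
  have h1 : ‖u‖ ≤ C * ‖LinearMap.pi g u‖ := by
    simpa using hanti.le_mul_dist u 0
  refine h1.trans (mul_le_mul_of_nonneg_left ?_ hC'.le)
  exact (pi_norm_le_iff_of_nonneg (abs_nonneg _)).2 hi

theorem isCompact_iInter_halfspaces {n : ℕ}
    {g : Fin (n + 1) → EuclideanSpace ℝ (Fin n) →ₗ[ℝ] ℝ} (hsum : ∀ z, ∑ i, g i z = 0)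
    (hinj : ∀ u, (∀ i, g i u = 0) → u = 0) (b : Fin (n + 1) → ℝ) :
    IsCompact {z | ∀ i, g i z ≤ b i} := by
  obtain ⟨c, hc, hcu⟩ := exists_pos_le_abs_apply hinj
  refine Metric.isCompact_of_isClosed_isBounded ?_ ?_
  · rw [Set.ofPred_forall]
    exact isClosed_iInter fun i =>
      isClosed_le (g i).continuous_of_finiteDimensional continuous_const
  · refine isBounded_iff_forall_norm_le.2 ⟨(∑ i, |b i|) / c, fun z hz => ?_⟩
    obtain ⟨i, hi⟩ := hcu z
    rw [le_div_iff₀ hc, mul_comm]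
    refine hi.trans (abs_le.2 ⟨?_, ?_⟩)
    -- The zero sum turns upper bounds on the other functionals into a lower bound on this one.
    · have h1 := hsum z
      rw [← Finset.add_sum_erase _ _ (Finset.mem_univ i)] at h1
      have h2 : ∑ j ∈ Finset.univ.erase i, g j z ≤ ∑ j ∈ Finset.univ.erase i, |b j| :=
        Finset.sum_le_sum fun j _ => (hz j).trans (le_abs_self _)
      have h3 : ∑ j ∈ Finset.univ.erase i, |b j| ≤ ∑ j, |b j| :=
        Finset.sum_le_sum_of_subset_of_nonneg (Finset.erase_subset _ _) fun _ _ _ => abs_nonneg _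
      linarith
    · exact ((hz i).trans (le_abs_self _)).trans
        (Finset.single_le_sum (f := fun j => |b j|) (fun _ _ => abs_nonneg _) (Finset.mem_univ i))

theorem exists_uniform_sliding {n : ℕ} {K : Set (EuclideanSpace ℝ (Fin n))} (hKc : IsCompact K)
    {x : Fin (n + 1) → EuclideanSpace ℝ (Fin n)}
    {g : Fin (n + 1) → EuclideanSpace ℝ (Fin n) →ₗ[ℝ] ℝ} (hx : Function.Injective x)
    (hsum : ∀ z, ∑ i, g i z = 0) (hinj : ∀ u, (∀ i, g i u = 0) → u = 0)
    (hg : ∀ i, ∀ y ∈ K, y ≠ x i → g i y < g i (x i)) :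
    ∃ δ > 0, ∀ u, ‖u‖ = 1 → ∃ v, ∀ y ∈ K, ∃ t : ℝ, ∀ i, g i (y + v + t • u) ≤ g i (x i) - δ := by
  obtain ⟨η, hη, hslack⟩ := exists_uniform_slack hKc hx hg
  obtain ⟨c, hc, hcu⟩ := exists_pos_le_abs_apply hinj
  obtain ⟨A, hA, hAu⟩ : ∃ A > 0, ∀ i u, ‖u‖ = 1 → |g i u| ≤ A := by
    let G := LinearMap.toContinuousLinearMap (LinearMap.pi g)
    refine ⟨‖G‖ + 1, by positivity, fun i u hu => ?_⟩
    have h1 : ‖G u‖ ≤ ‖G‖ := by simpa [hu] using G.le_opNorm u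
    have h2 : |g i u| ≤ ‖G u‖ := norm_le_pi_norm (G u) i
    linarith
  have hnonneg : ∀ i, ∀ y ∈ K, 0 ≤ g i (x i) - g i y := fun i y hy => by
    by_cases h : y = x i
    · simp [h]
    · exact (sub_pos.2 (hg i y hy h)).le
  set τ := η / A with hτ
  have hτ0 : 0 < τ := by positivity
  have hτA : τ * A = η := by rw [hτ]; field_simp
  -- Both the slack `η` and the gain `τ * c` from sliding must cover the `(n + 1) * δ` needed at
  -- `k`.
  set δ := min η (τ * c) / (n + 1) with hδ
  have hδ0 : 0 < δ := by positivity
  have hδm : (n + 1) * δ = min η (τ * c) := by rw [hδ]; field_simp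
  have hδη : (n + 1) * δ ≤ η := hδm.trans_le (min_le_left _ _)
  have hδτ : (n + 1) * δ ≤ τ * c := hδm.trans_le (min_le_right _ _)
  refine ⟨δ, hδ0, fun u hu => ?_⟩
  obtain ⟨k, hk⟩ := hcu u
  rw [hu, mul_one] at hk
  obtain ⟨v, hv⟩ := exists_forall_apply_eq_of_sum_eq_zero hsum hinj
    (b := fun i => (if i = k then (n + 1) * δ else 0) - δ) (by simp)
  refine ⟨v, fun y hy => ?_⟩
  simp only [map_add, map_smul, smul_eq_mul, hv]
  by_cases hky : g k (x k) - g k y < η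
  · obtain ⟨t, ht, htk⟩ : ∃ t : ℝ, |t| = τ ∧ t * g k u = -(τ * |g k u|) := by
      rcases le_total 0 (g k u) with h | h
      · exact ⟨-τ, by rw [abs_neg, abs_of_pos hτ0], by rw [abs_of_nonneg h]; ring⟩
      · exact ⟨τ, abs_of_pos hτ0, by rw [abs_of_nonpos h]; ring⟩
    refine ⟨t, fun i => ?_⟩
    by_cases hi : i = k
    · subst hi
      have := mul_le_mul_of_nonneg_left hk hτ0.le
      have := hnonneg i y hy
      simp only [if_true]
      linarith
    · have h1 := hslack y hy k i (Ne.symm hi) hky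
      have h2 : t * g i u ≤ η := by
        refine (le_abs_self _).trans ?_
        rw [abs_mul, ht, ← hτA]
        exact mul_le_mul_of_nonneg_left (hAu i u hu) hτ0.le
      simp only [hi, if_false]
      linarith
  · refine ⟨0, fun i => ?_⟩
    by_cases hi : i = k
    · subst hi
      simp only [if_true]
      linarith
    · have := hnonneg i y hy
      simp only [hi, if_false]
      linarith

/-! ### The simplex `L` -/

theorem affineSpan_eq_top_of_affineDim_eq {n : ℕ} (hn : 1 ≤ n)
    {K : Set (EuclideanSpace ℝ (Fin n))} (hK : affineDim K = n) : affineSpan ℝ K = ⊤ := by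
  have hne : K.Nonempty := by
    rw [Set.nonempty_iff_ne_empty]
    rintro rfl
    rw [affineDim, AffineSubspace.span_empty, AffineSubspace.direction_bot, finrank_bot] at hK
    omega
  rw [← AffineSubspace.direction_eq_top_iff_of_nonempty ((affineSpan_nonempty ℝ).2 hne)]
  exact Submodule.eq_top_of_finrank_eq (by simpa [affineDim] using hK)

theorem corollary4p5 (n : ℕ) (hn : 1 ≤ n) (K : Set (EuclideanSpace ℝ (Fin n)))
    (hKcompact : IsCompact K) (hKconvex : Convex ℝ K) (hKdim : affineDim K = n) :
    ∃ L : Set (EuclideanSpace ℝ (Fin n)),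
      L.Nonempty ∧ IsCompact L ∧ Convex ℝ L ∧
      (∀ u : EuclideanSpace ℝ (Fin n), ‖u‖ = 1 →
        ∃ v ∈ (Submodule.span ℝ {u})ᗮ, setTranslate (shadow u K) v ⊆ shadow u L) ∧
      ¬ ∃ w : EuclideanSpace ℝ (Fin n), setTranslate K w ⊆ L := by
  obtain ⟨x, g, hxK, hx, hsum, hinj, hg⟩ :=
    exists_exposing_functionals hn hKcompact (affineSpan_eq_top_of_affineDim_eq hn hKdim)
  obtain ⟨δ, hδ, hslide⟩ := exists_uniform_sliding hKcompact hx hsum hinj hg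
  refine ⟨{z | ∀ i, g i z ≤ g i (x i) - δ}, ?_, isCompact_iInter_halfspaces hsum hinj _, ?_, ?_, ?_⟩
  · obtain ⟨v, hv⟩ := hslide (EuclideanSpace.single ⟨0, hn⟩ 1) (by simp)
    obtain ⟨t, ht⟩ := hv (x 0) (hxK 0)
    exact ⟨_, ht⟩
  · rw [Set.ofPred_forall]
    exact convex_iInter fun i => convex_halfSpace_le (g i).isLinear _
  · intro u hu
    obtain ⟨v, hv⟩ := hslide u hu
    refine ⟨(Submodule.span ℝ {u})ᗮ.starProjection v, Submodule.starProjection_apply_mem _ _, ?_⟩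
    rintro _ ⟨_, ⟨y, hy, rfl⟩, rfl⟩
    obtain ⟨t, ht⟩ := hv y hy
    refine ⟨_, ht, ?_⟩
    have hu0 : (Submodule.span ℝ {u})ᗮ.starProjection u = 0 := by
      rw [Submodule.starProjection_apply_eq_zero_iff, Submodule.orthogonal_orthogonal]
      exact Submodule.mem_span_singleton_self u
    simp only [map_add, map_smul, hu0, smul_zero, add_zero]
  · rintro ⟨w, hw⟩
    have h : ∀ i, g i w ≤ -δ := fun i => by
      have := hw ⟨x i, hxK i, rfl⟩ i
      simp only [map_add] at this
      linarith
    have h1 := Finset.sum_le_sum fun i (_ : i ∈ Finset.univ) => h i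
    rw [hsum] at h1
    simp at h1
    have : (0 : ℝ) < (n + 1) * δ := by positivity
    linarith
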